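/- Let $G$ be a group, let $A,B$ be sets, and let $C\colon B\times A\to G$ be a matrix that is normalized with respect to $a_0\in A$ and $b_0\in B$, i.e. $C_{b_0a}=1=C_{ba_0}$ for all $a\in A$, $b\in B$. Put $\overline A=A\setminus\{a_0\}$ and $\overline B=B\setminus\{b_0\}$. Let $S=\mathcal M(G,A,B,C)$ be the Rees matrix semigroup, that is, the set $A\times G\times B$ with multiplication $(a,g,b)(a',g',b')=(a,gC_{ba'}g',b')$, and let $M=S^1$ be the monoid obtained from $S$ by adjoining an identity. Suppose that $M$ is of type (left) $\mathrm{FP}_2$, i.e. that the trivial left $\mathbb ZM$-module $\mathbb Z$ has a projective resolution $\cdots\to P_1\to P_0\to\mathbb Z\to 0$ with $P_0,P_1,P_2$ finitely generated. If $B$ is infinite and $A$ has at least two elements, then the subgroup $\langle C_{ba}[G,G]\mid (a,b)\in\overline A\times\overline B\rangle$ of the abelianization $G/[G,G]$ is not finitely generated, and hence $G$ is not finitely generated. -/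

import Mathlib

universe u v

/-- The Rees matrix semigroup `ℳ(G, A, B, C)`: the set `A × G × B`, where `C : B × A → G` is the
sandwich matrix. -/
@[ext]
structure ReesMatrix {G : Type*} {A : Type*} {B : Type*} (C : B → A → G) where
  /-- The component in `A`. -/
  row : A
  /-- The component in `G`. -/
  elt : G
  /-- The component in `B`. -/
  col : B

/-- The product `(a, g, b) (a', g', b') = (a, g C_{ba'} g', b')`. -/
instance ReesMatrix.instSemigroup {G : Type*} {A : Type*} {B : Type*} [Group G]
    (C : B → A → G) : Semigroup (ReesMatrix C) where
  mul s t := ⟨s.row, s.elt * C s.col t.row * t.elt, t.col⟩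
  mul_assoc s t u := by
    apply ReesMatrix.ext
    · rfl
    · change s.elt * C s.col t.row * t.elt * C t.col u.row * u.elt
        = s.elt * C s.col t.row * (t.elt * C t.col u.row * u.elt)
      simp only [mul_assoc]
    · rfl

/-- The left `R`-module `V` is of type `FP_n`: it has a projective resolution
`⋯ → P₁ → P₀ → V → 0` with `P₀, …, Pₙ` finitely generated. -/
def ModuleTypeFP (R : Type u) [Ring R] (V : Type v) [AddCommGroup V] [Module R V]
    (n : ℕ) : Prop :=
  ∃ (P : ℕ → Type (max u v)) (_ : ∀ i, AddCommGroup (P i)) (_ : ∀ i, Module R (P i))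
    (d : ∀ i, P (i + 1) →ₗ[R] P i) (ε : P 0 →ₗ[R] V),
    (∀ i, Module.Projective R (P i)) ∧
    Function.Surjective ε ∧
    Function.Exact (d 0) ε ∧
    (∀ i, Function.Exact (d (i + 1)) (d i)) ∧
    ∀ i ≤ n, Module.Finite R (P i)

/-- The monoid `M` is of type (left) `FP_n`: the trivial left `ℤM`-module `ℤ` is of type `FP_n`. -/
def MonoidTypeFP (M : Type u) [Monoid M] (n : ℕ) : Prop :=
  ModuleTypeFP (MonoidAlgebra ℤ M) (Representation.trivial ℤ M ℤ).asModule n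

/-! Let `F` be free abelian on pairs `(a, b)` with `a ≠ a₀`, `b ≠ b₀`, and let `π : F → G/[G,G]`
send `(a, b)` to the class of `C b a`. Type `FP₂` forces any `2`-cocycle on `M` to take the
`2`-cycles of the bar complex into a finitely generated group
(`MonoidTypeFP.exists_fg_of_isNormalizedCocycle`). The cocycle `reesCocycle` has values in `F`, and
its values on `2`-cycles exhaust `ker π` (`exists_cycle_of_reesToAbelianization_eq_zero`), so `ker
π` is finitely generated. If the image of `π` were finitely generated too, so would be `F`, which
has infinite rank. -/

/-- The augmentation `ℤM → ℤ` as a linear map onto the trivial module. -/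
noncomputable def trivialAugmentation (M : Type*) [Monoid M] :
    MonoidAlgebra ℤ M →ₗ[MonoidAlgebra ℤ M] (Representation.trivial ℤ M ℤ).asModule :=
  LinearMap.toSpanSingleton _ _ ((Representation.trivial ℤ M ℤ).asModuleEquiv.symm 1)

/-- The first differential `[m] ↦ m - 1` of the bar resolution. -/
noncomputable def barDifferential (M : Type*) [Monoid M] :
    (M →₀ MonoidAlgebra ℤ M) →ₗ[MonoidAlgebra ℤ M] MonoidAlgebra ℤ M :=
  Finsupp.linearCombination _ fun m => MonoidAlgebra.single m 1 - 1

/-- The second differential `(m, n) ↦ [n] - [mn] + [m]` of the bar complex with trivial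
coefficients. -/
noncomputable def barBoundary (M : Type*) [Monoid M] : (M × M →₀ ℤ) →ₗ[ℤ] (M →₀ ℤ) :=
  Finsupp.linearCombination ℤ fun p =>
    Finsupp.single p.2 1 - Finsupp.single (p.1 * p.2) 1 + Finsupp.single p.1 1

/-- The linear extension to `ℤM` of a map on `M`. -/
noncomputable def MonoidAlgebra.liftInt {M T : Type*} [AddCommGroup T] (f : M → T) :
    MonoidAlgebra ℤ M →+ T :=
  (Finsupp.linearCombination ℤ f).toAddMonoidHom.comp
    (MonoidAlgebra.coeffAddEquiv (R := ℤ) (M := M)).toAddMonoidHom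

theorem MonoidAlgebra.liftInt_single {M T : Type*} [AddCommGroup T] (f : M → T) (m : M) (k : ℤ) :
    MonoidAlgebra.liftInt f (MonoidAlgebra.single m k) = k • f m :=
  Finsupp.linearCombination_single ℤ k m

section Bar

variable {M : Type*} [Monoid M]

theorem trivial_asModule_single_smul (m : M) (k : ℤ)
    (v : (Representation.trivial ℤ M ℤ).asModule) :
    (MonoidAlgebra.single m k) • v = k • v := by
  apply (Representation.trivial ℤ M ℤ).asModuleEquiv.injective
  rw [Representation.asModuleEquiv_map_smul]
  simp [Representation.asAlgebraHom_single]

theorem trivialAugmentation_single (m : M) (k : ℤ) :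
    trivialAugmentation M (MonoidAlgebra.single m k)
      = (Representation.trivial ℤ M ℤ).asModuleEquiv.symm k := by
  rw [trivialAugmentation, LinearMap.toSpanSingleton_apply, trivial_asModule_single_smul,
    ← map_zsmul]
  simp

theorem trivialAugmentation_surjective : Function.Surjective (trivialAugmentation M) := fun v =>
  ⟨MonoidAlgebra.single 1 ((Representation.trivial ℤ M ℤ).asModuleEquiv v), by
    rw [trivialAugmentation_single, LinearEquiv.symm_apply_apply]⟩

theorem barDifferential_single (m : M) (x : MonoidAlgebra ℤ M) :
    barDifferential M (Finsupp.single m x) = x * (MonoidAlgebra.single m 1 - 1) := by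
  simp [barDifferential]

theorem exists_barDifferential_eq (x : MonoidAlgebra ℤ M) :
    ∃ (y : M →₀ MonoidAlgebra ℤ M) (k : ℤ),
      x = barDifferential M y + MonoidAlgebra.single 1 k := by
  induction x using MonoidAlgebra.induction_linear with
  | zero => exact ⟨0, 0, by simp⟩
  | add f g hf hg =>
    obtain ⟨y, k, hy⟩ := hf
    obtain ⟨z, l, hz⟩ := hg
    exact ⟨y + z, k + l, by rw [hy, hz, map_add, MonoidAlgebra.single_add]; abel⟩
  | single m k =>
    refine ⟨Finsupp.single m (MonoidAlgebra.single 1 k), k, ?_⟩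
    rw [barDifferential_single, mul_sub, MonoidAlgebra.single_mul_single]
    simp

theorem barDifferential_exact :
    Function.Exact (barDifferential M) (trivialAugmentation M) := by
  have h0 : ∀ y, trivialAugmentation M (barDifferential M y) = 0 := by
    intro y
    induction y using Finsupp.induction_linear with
    | zero => simp
    | add f g hf hg => rw [map_add, map_add, hf, hg, add_zero]
    | single m x =>
      rw [barDifferential_single, ← smul_eq_mul, map_smul, map_sub, MonoidAlgebra.one_def,
        trivialAugmentation_single, trivialAugmentation_single, sub_self, smul_zero]
  intro x
  constructor
  · intro hx
    obtain ⟨y, k, rfl⟩ := exists_barDifferential_eq x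
    rw [map_add, h0, zero_add, trivialAugmentation_single, LinearEquiv.map_eq_zero_iff] at hx
    exact ⟨y, by simp [hx]⟩
  · rintro ⟨y, rfl⟩
    exact h0 y

/-! ### Comparison of the bar resolution with a finite-type resolution -/

/-- A projective module maps to an exact sequence by lifting cycles to chains. -/
theorem Module.exists_lift_of_exact {R P X Y Z : Type*} [Ring R] [AddCommGroup P] [Module R P]
    [AddCommGroup X] [Module R X] [AddCommGroup Y] [Module R Y] [AddCommGroup Z] [Module R Z]
    [Module.Projective R P] {f : X →ₗ[R] Y} {g : Y →ₗ[R] Z} (hfg : Function.Exact f g)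
    (p : P →ₗ[R] Y) (hp : ∀ x, g (p x) = 0) : ∃ q : P →ₗ[R] X, ∀ x, f (q x) = p x := by
  have hsurj : Function.Surjective f.rangeRestrict := LinearMap.surjective_rangeRestrict f
  obtain ⟨q, hq⟩ := Module.projective_lifting_property f.rangeRestrict
    (p.codRestrict (LinearMap.range f) fun x => (hfg (p x)).1 (hp x)) hsurj
  exact ⟨q, fun x => congrArg Subtype.val (LinearMap.congr_fun hq x)⟩

/-- If the trivial module is of type `FP₂`, then the endomorphism of the bar resolution induced by
factoring through a resolution is, on `1`-chains, homotopic to the identity and factors on cycles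
through a finitely generated module. -/
theorem MonoidTypeFP.exists_factorization {M : Type u} [Monoid M] (h : MonoidTypeFP M 2) :
    ∃ (P : Type u) (_ : AddCommGroup P) (_ : Module (MonoidAlgebra ℤ M) P)
      (_ : Module.Finite (MonoidAlgebra ℤ M) P)
      (f : P →ₗ[MonoidAlgebra ℤ M] (M →₀ MonoidAlgebra ℤ M))
      (κ : (M →₀ MonoidAlgebra ℤ M) →ₗ[MonoidAlgebra ℤ M] (M →₀ MonoidAlgebra ℤ M)),
      (∀ p, barDifferential M (f p) = 0) ∧ (∀ x, barDifferential M (κ x) = 0) ∧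
      ∀ x, barDifferential M x = 0 → ∃ p, f p = x + κ x := by
  obtain ⟨P, instA, instM, d, ε, hproj, hε, hex0, hex, hfin⟩ := h
  have := hproj 0
  have := hproj 1
  obtain ⟨φ₀, hφ₀⟩ := Module.projective_lifting_property ε (trivialAugmentation M) hε
  obtain ⟨ψ₀, hψ₀⟩ := Module.projective_lifting_property (trivialAugmentation M) ε
    trivialAugmentation_surjective
  replace hφ₀ := LinearMap.congr_fun hφ₀
  replace hψ₀ := LinearMap.congr_fun hψ₀
  simp only [LinearMap.comp_apply] at hφ₀ hψ₀
  obtain ⟨φ₁, hφ₁⟩ := Module.exists_lift_of_exact hex0 (φ₀ ∘ₗ barDifferential M) fun x => by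
    rw [LinearMap.comp_apply, hφ₀]
    exact (barDifferential_exact _).2 ⟨x, rfl⟩
  obtain ⟨ψ₁, hψ₁⟩ := Module.exists_lift_of_exact barDifferential_exact (ψ₀ ∘ₗ d 0) fun x => by
    rw [LinearMap.comp_apply, hψ₀]
    exact (hex0 _).2 ⟨x, rfl⟩
  obtain ⟨σ, hσ⟩ := Module.exists_lift_of_exact barDifferential_exact
    (ψ₀ ∘ₗ φ₀ - LinearMap.id) fun x => by
      rw [LinearMap.sub_apply, LinearMap.comp_apply, map_sub, hψ₀, hφ₀, LinearMap.id_apply,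
        sub_self]
  simp only [LinearMap.comp_apply, LinearMap.sub_apply, LinearMap.id_apply] at hφ₁ hψ₁ hσ
  -- The defect `κ` of the homotopy takes values in cycles. It is kept as it stands instead of being
  -- written as a boundary, so no `2`-chains of the bar resolution are needed.
  refine ⟨P 2, instA 2, instM 2, hfin 2 le_rfl, ψ₁ ∘ₗ d 1,
    ψ₁ ∘ₗ φ₁ - LinearMap.id - σ ∘ₗ barDifferential M, fun p => ?_, fun x => ?_, fun x hx => ?_⟩
  · rw [LinearMap.comp_apply, hψ₁, (hex 0 _).2 ⟨p, rfl⟩, map_zero]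
  · simp only [LinearMap.comp_apply, LinearMap.sub_apply, LinearMap.id_apply, map_sub, hψ₁, hφ₁,
      hσ]
    abel
  · obtain ⟨p, hp⟩ := (hex 0 (φ₁ x)).1 (by rw [hφ₁, hx, map_zero])
    refine ⟨p, ?_⟩
    have hp' : d 1 p = φ₁ x := hp
    simp only [LinearMap.comp_apply, LinearMap.sub_apply, LinearMap.id_apply, hx, map_zero, hp']
    abel

/-- The range of an additive map from a finitely generated `ℤM`-module that is constant on
`M`-orbits is finitely generated. -/
theorem fg_range_of_invariant {P T : Type*} [AddCommGroup P] [Module (MonoidAlgebra ℤ M) P]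
    [Module.Finite (MonoidAlgebra ℤ M) P] [AddCommGroup T] (f : P →+ T)
    (hf : ∀ (m : M) (p : P), f (MonoidAlgebra.single m (1 : ℤ) • p) = f p) :
    (LinearMap.range f.toIntLinearMap).FG := by
  classical
  obtain ⟨s, hs⟩ := Module.Finite.fg_top (R := MonoidAlgebra ℤ M) (M := P)
  refine ⟨s.image f, le_antisymm ?_ ?_⟩
  · rw [Submodule.span_le]
    intro t ht
    obtain ⟨p, -, rfl⟩ := Finset.mem_image.1 (Finset.mem_coe.1 ht)
    exact ⟨p, rfl⟩
  · rintro _ ⟨p, rfl⟩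
    have hp : p ∈ Submodule.span (MonoidAlgebra ℤ M) (s : Set P) := hs ▸ Submodule.mem_top
    change f p ∈ _
    induction hp using Submodule.span_induction with
    | mem x hx => exact Submodule.subset_span (Finset.mem_coe.2 (Finset.mem_image_of_mem f hx))
    | zero => rw [map_zero]; exact zero_mem _
    | add x y _ _ hx hy => rw [map_add]; exact add_mem hx hy
    | smul a x _ hx =>
      induction a using MonoidAlgebra.induction_linear with
      | zero => rw [zero_smul, map_zero]; exact zero_mem _
      | add a b ha hb => rw [add_smul, map_add]; exact add_mem ha hb
      | single m k =>
        have : MonoidAlgebra.single m k • x = k • (MonoidAlgebra.single m (1 : ℤ) • x) := by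
          rw [← smul_assoc, MonoidAlgebra.smul_single, smul_eq_mul, mul_one]
        rw [this, map_zsmul, hf]
        exact Submodule.smul_mem _ k hx

/-! ### Cocycles evaluated on cycles -/

/-- The pairing `m[n] ↦ c(m, n)` of a cochain `c` with the `1`-chains of the bar resolution. -/
noncomputable def cochainPairing {T : Type*} [AddCommGroup T] (c : M → M → T) :
    (M →₀ MonoidAlgebra ℤ M) →+ T :=
  Finsupp.liftAddHom fun n => MonoidAlgebra.liftInt fun m => c m n

theorem cochainPairing_single {T : Type*} [AddCommGroup T] (c : M → M → T) (m n : M) (k : ℤ) :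
    cochainPairing c (Finsupp.single n (MonoidAlgebra.single m k)) = k • c m n := by
  rw [cochainPairing, Finsupp.liftAddHom_apply_single, MonoidAlgebra.liftInt_single]

/-- A normalized `2`-cocycle with trivial coefficients. -/
structure IsNormalizedCocycle {T : Type*} [AddCommGroup T] (c : M → M → T) : Prop where
  one_left : ∀ m, c 1 m = 0
  cocycle : ∀ m n k, c n k + c m (n * k) = c (m * n) k + c m n

/-- The cocycle identity reads `c(sm, n) = c(m, n) + c(s, mn) - c(s, m)`, and `mn - m` is the
differential of `m[n]`. Hence the pairing is `M`-invariant on cycles. -/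
theorem IsNormalizedCocycle.cochainPairing_smul {T : Type*} [AddCommGroup T] {c : M → M → T}
    (hc : IsNormalizedCocycle c) (s : M) (x : M →₀ MonoidAlgebra ℤ M) :
    cochainPairing c (MonoidAlgebra.single s (1 : ℤ) • x)
      = cochainPairing c x + MonoidAlgebra.liftInt (c s) (barDifferential M x) := by
  induction x using Finsupp.induction_linear with
  | zero => simp
  | add f g hf hg => rw [smul_add, map_add, hf, hg, map_add, map_add, map_add]; abel
  | single n a =>
    induction a using MonoidAlgebra.induction_linear with
    | zero => simp
    | add a b ha hb =>
      rw [Finsupp.single_add, smul_add, map_add, ha, hb, map_add, map_add, map_add]; abel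
    | single m k =>
      rw [Finsupp.smul_single, smul_eq_mul, MonoidAlgebra.single_mul_single, one_mul,
        cochainPairing_single, cochainPairing_single, barDifferential_single, mul_sub, mul_one,
        MonoidAlgebra.single_mul_single, mul_one, map_sub, MonoidAlgebra.liftInt_single,
        MonoidAlgebra.liftInt_single, eq_sub_of_add_eq (hc.cocycle s m n).symm]
      simp only [smul_sub, smul_add]
      abel

theorem IsNormalizedCocycle.cochainPairing_smul_of_cycle {T : Type*} [AddCommGroup T]
    {c : M → M → T} (hc : IsNormalizedCocycle c) (s : M) {x : M →₀ MonoidAlgebra ℤ M}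
    (hx : barDifferential M x = 0) :
    cochainPairing c (MonoidAlgebra.single s (1 : ℤ) • x) = cochainPairing c x := by
  rw [hc.cochainPairing_smul, hx, map_zero, add_zero]

/-- Every `2`-cycle `z` of the bar complex lifts to a `1`-cycle of the bar resolution, which pairs
with a cocycle as `z` does, and on which invariant functionals vanish. -/
theorem exists_lift_of_barBoundary_eq_zero {T : Type*} [AddCommGroup T] {c : M → M → T}
    (hc : IsNormalizedCocycle c) {z : M × M →₀ ℤ} (hz : barBoundary M z = 0) :
    ∃ x, barDifferential M x = 0 ∧
      cochainPairing c x = Finsupp.linearCombination ℤ (fun p : M × M => c p.1 p.2) z ∧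
      ∀ f : (M →₀ MonoidAlgebra ℤ M) →+ T,
        (∀ (m : M) x, f (MonoidAlgebra.single m (1 : ℤ) • x) = f x) → f x = 0 := by
  let e : M → M →₀ MonoidAlgebra ℤ M := fun m => Finsupp.single m 1
  -- Being a cycle does not survive induction on `z`, so the claim is made for all `z`, with `f x`
  -- expressed through the boundary of `z`.
  have key : ∀ z : M × M →₀ ℤ, ∃ x, barDifferential M x = 0 ∧
      cochainPairing c x = Finsupp.linearCombination ℤ (fun p : M × M => c p.1 p.2) z ∧
      ∀ f : (M →₀ MonoidAlgebra ℤ M) →+ T,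
        (∀ (m : M) x, f (MonoidAlgebra.single m (1 : ℤ) • x) = f x) →
          f x = Finsupp.linearCombination ℤ (fun m => f (e m)) (barBoundary M z) := by
    intro z
    induction z using Finsupp.induction_linear with
    | zero => exact ⟨0, by simp, by simp, by simp⟩
    | add z w hz hw =>
      obtain ⟨x, hx, hcx, hfx⟩ := hz
      obtain ⟨y, hy, hcy, hfy⟩ := hw
      exact ⟨x + y, by rw [map_add, hx, hy, add_zero], by rw [map_add, map_add, hcx, hcy],
        fun f hf => by rw [map_add, map_add, map_add, hfx f hf, hfy f hf]⟩
    | single p k =>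
      obtain ⟨m, n⟩ := p
      -- This is the boundary of `[m|n]` in the bar resolution.
      refine ⟨k • (MonoidAlgebra.single m (1 : ℤ) • e n - e (m * n) + e m), ?_, ?_, ?_⟩
      · rw [map_zsmul, map_add, map_sub, map_smul, barDifferential_single, barDifferential_single,
          barDifferential_single]
        simp only [one_mul, smul_eq_mul, mul_sub, MonoidAlgebra.single_mul_single, mul_one]
        rw [sub_sub_sub_comm, sub_self, zero_sub, neg_sub, sub_add_sub_cancel]
        simp
      · rw [map_zsmul, map_add, map_sub, hc.cochainPairing_smul, barDifferential_single, one_mul,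
          map_sub, MonoidAlgebra.one_def, MonoidAlgebra.liftInt_single,
          MonoidAlgebra.liftInt_single]
        simp only [e, MonoidAlgebra.one_def, cochainPairing_single, hc.one_left]
        have h1 : c m 1 = 0 := by
          have := hc.cocycle m 1 1
          rw [one_mul, mul_one, hc.one_left, zero_add] at this
          exact left_eq_add.1 this
        simp [h1]
      · intro f hf
        rw [map_zsmul, map_add, map_sub, hf, barBoundary, Finsupp.linearCombination_single,
          map_smul, map_add, map_sub, Finsupp.linearCombination_single,
          Finsupp.linearCombination_single, Finsupp.linearCombination_single]
        simp
  obtain ⟨x, hx, hcx, hfx⟩ := key z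
  exact ⟨x, hx, hcx, fun f hf => by rw [hfx f hf, hz, map_zero]⟩

/-- If `M` is of type `FP₂`, a normalized `2`-cocycle takes the `2`-cycles of the bar complex into
a finitely generated group. -/
theorem MonoidTypeFP.exists_fg_of_isNormalizedCocycle (h : MonoidTypeFP M 2) {T : Type*}
    [AddCommGroup T] {c : M → M → T} (hc : IsNormalizedCocycle c) :
    ∃ N : Submodule ℤ T, N.FG ∧ ∀ z, barBoundary M z = 0 →
      Finsupp.linearCombination ℤ (fun p : M × M => c p.1 p.2) z ∈ N := by
  obtain ⟨P, _, _, _, f, κ, hf, hκ, hfac⟩ := h.exists_factorization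
  refine ⟨_, fg_range_of_invariant (M := M) ((cochainPairing c).comp f.toAddMonoidHom)
    fun m p => ?_, fun z hz => ?_⟩
  · change cochainPairing c (f _) = cochainPairing c (f p)
    rw [map_smul, hc.cochainPairing_smul_of_cycle m (hf p)]
  · obtain ⟨x, hx, hcx, hinv⟩ := exists_lift_of_barBoundary_eq_zero hc hz
    obtain ⟨p, hp⟩ := hfac x hx
    refine ⟨p, ?_⟩
    change cochainPairing c (f p) = _
    have hκx := hinv ((cochainPairing c).comp κ.toAddMonoidHom) fun m y => by
      change cochainPairing c (κ _) = cochainPairing c (κ y)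
      rw [map_smul, hc.cochainPairing_smul_of_cycle m (hκ y)]
    have hκx' : cochainPairing c (κ x) = 0 := hκx
    rw [hp, map_add, hκx', add_zero, hcx]

end Bar

/-! ### The cocycle of a Rees matrix semigroup -/

section Rees

variable {G A B : Type*} (C : B → A → G) (a₀ : A) (b₀ : B)

open Classical in
/-- The generator indexed by `(a, b)`, read as zero if `a = a₀` or `b = b₀`. -/
noncomputable def reesGenerator (a : A) (b : B) : ({a // a ≠ a₀} × {b // b ≠ b₀}) →₀ ℤ :=
  if h : a ≠ a₀ ∧ b ≠ b₀ then Finsupp.single (⟨a, h.1⟩, ⟨b, h.2⟩) 1 else 0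

/-- The cocycle on `S¹` sending a product `(a, g, b) (a', g', b')` to the generator indexed by
`(a', b)`. -/
noncomputable def reesCocycle :
    WithOne (ReesMatrix C) → WithOne (ReesMatrix C) → ({a // a ≠ a₀} × {b // b ≠ b₀}) →₀ ℤ
  | some s, some t => reesGenerator a₀ b₀ t.row s.col
  | none, _ => 0
  | some _, none => 0

theorem reesCocycle_coe (s t : ReesMatrix C) :
    reesCocycle C a₀ b₀ (s : WithOne (ReesMatrix C)) t = reesGenerator a₀ b₀ t.row s.col := rfl

theorem reesCocycle_one_left (t : WithOne (ReesMatrix C)) : reesCocycle C a₀ b₀ 1 t = 0 := rfl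

theorem reesCocycle_one_right (t : WithOne (ReesMatrix C)) : reesCocycle C a₀ b₀ t 1 = 0 := by
  cases t <;> rfl

variable [Group G]

/-- A product keeps the row of its left factor and the column of its right factor, so on `S` both
sides of the identity are the same two generators. -/
theorem isNormalizedCocycle_reesCocycle : IsNormalizedCocycle (reesCocycle C a₀ b₀) where
  one_left := reesCocycle_one_left C a₀ b₀
  cocycle m n k := by
    cases m with
    | one => simp [reesCocycle_one_left]
    | coe m =>
    cases n with
    | one => simp [reesCocycle_one_left, reesCocycle_one_right]
    | coe n =>
    cases k with
    | one => simp [reesCocycle_one_right]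
    | coe k =>
      rw [← WithOne.coe_mul, ← WithOne.coe_mul]
      simp only [reesCocycle_coe]
      rfl

/-- The map sending the generator `(a, b)` to the class of `C b a`. -/
noncomputable def reesToAbelianization :
    (({a // a ≠ a₀} × {b // b ≠ b₀}) →₀ ℤ) →ₗ[ℤ] Additive (Abelianization G) :=
  Finsupp.linearCombination ℤ fun p => Additive.ofMul (Abelianization.of (C p.2 p.1))

variable {C a₀ b₀}

/-- Every relation between the classes of the entries of the sandwich matrix is the value of the
cocycle on a `2`-cycle. -/
theorem exists_cycle_of_reesToAbelianization_eq_zero (hrow : ∀ a, C b₀ a = 1)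
    (hcol : ∀ b, C b a₀ = 1) {t : ({a // a ≠ a₀} × {b // b ≠ b₀}) →₀ ℤ}
    (ht : reesToAbelianization C a₀ b₀ t = 0) :
    ∃ z, barBoundary (WithOne (ReesMatrix C)) z = 0 ∧
      Finsupp.linearCombination ℤ
        (fun p : WithOne (ReesMatrix C) × WithOne (ReesMatrix C) =>
          reesCocycle C a₀ b₀ p.1 p.2) z = t := by
  set M := WithOne (ReesMatrix C)
  -- `(0, t)` lies in `W` exactly when `t` is the value of the cocycle on a `2`-cycle. Modulo `W`,
  -- the map `q` is additive up to the cocycle.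
  let W := LinearMap.range ((barBoundary M).prod
    (Finsupp.linearCombination ℤ fun p : M × M => reesCocycle C a₀ b₀ p.1 p.2))
  let q : M → (((M →₀ ℤ) × (({a // a ≠ a₀} × {b // b ≠ b₀}) →₀ ℤ)) ⧸ W) :=
    fun m => W.mkQ (Finsupp.single m 1, 0)
  have hq : ∀ m n, q (m * n) = q m + q n + W.mkQ (0, reesCocycle C a₀ b₀ m n) := by
    intro m n
    rw [← map_add, ← map_add, eq_comm, ← sub_eq_zero, ← map_sub, Submodule.mkQ_apply,
      Submodule.Quotient.mk_eq_zero]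
    refine ⟨Finsupp.single (m, n) 1, ?_⟩
    ext1
    · simp [barBoundary]; abel
    · simp
  have hW : W.mkQ (0, 0) = 0 := map_zero _
  have hq' : ∀ s t : ReesMatrix C, q ((s * t : ReesMatrix C) : M)
      = q (s : M) + q (t : M) + W.mkQ (0, reesGenerator a₀ b₀ t.row s.col) := fun s t => by
    rw [WithOne.coe_mul, hq, reesCocycle_coe]
  have hrow0 : ∀ b, reesGenerator a₀ b₀ a₀ b = 0 := fun b => by simp [reesGenerator]
  have hcol0 : ∀ a, reesGenerator a₀ b₀ a b₀ = 0 := fun a => by simp [reesGenerator]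
  have hmul : ∀ (s t : ReesMatrix C), s * t = ⟨s.row, s.elt * C s.col t.row * t.elt, t.col⟩ :=
    fun _ _ => rfl
  have hadd : ∀ g h : G, q ((⟨a₀, g * h, b₀⟩ : ReesMatrix C) : M)
      = q ((⟨a₀, g, b₀⟩ : ReesMatrix C) : M) + q ((⟨a₀, h, b₀⟩ : ReesMatrix C) : M) := by
    intro g h
    have := hq' ⟨a₀, g, b₀⟩ ⟨a₀, h, b₀⟩
    simpa [hmul, hrow, hrow0, hW, -WithOne.coe_mul, -Submodule.mkQ_apply] using this
  -- The target is abelian, so `ψ` factors through the abelianization.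
  let ψ : G →* Multiplicative (((M →₀ ℤ) × (({a // a ≠ a₀} × {b // b ≠ b₀}) →₀ ℤ)) ⧸ W) :=
    MonoidHom.mk' (fun g => Multiplicative.ofAdd (q ((⟨a₀, g, b₀⟩ : ReesMatrix C) : M))) hadd
  let Ψ := (MonoidHom.toAdditiveLeft (Abelianization.lift ψ)).toIntLinearMap
  have hone : q ((⟨a₀, 1, b₀⟩ : ReesMatrix C) : M) = 0 := by
    have := hadd 1 1
    rw [mul_one] at this
    exact left_eq_add.1 this
  have hleft : ∀ b, q ((⟨a₀, 1, b⟩ : ReesMatrix C) : M) = 0 := by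
    intro b
    have := (hq' ⟨a₀, 1, b⟩ ⟨a₀, 1, b₀⟩).symm
    simpa [hmul, hcol, hrow0, hone, hW, -WithOne.coe_mul, -Submodule.mkQ_apply] using this
  have hright : ∀ a, q ((⟨a, 1, b₀⟩ : ReesMatrix C) : M) = 0 := by
    intro a
    have := (hq' ⟨a₀, 1, b₀⟩ ⟨a, 1, b₀⟩).symm
    simpa [hmul, hrow, hcol0, hone, hW, -WithOne.coe_mul, -Submodule.mkQ_apply] using this
  -- Apply `q` to `(a₀, 1, b) (a, 1, b₀) = (a₀, C b a, b₀)`: both factors contribute zero, leaving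
  -- only the cocycle.
  have hC : ∀ a b, q ((⟨a₀, C b a, b₀⟩ : ReesMatrix C) : M)
      = W.mkQ (0, reesGenerator a₀ b₀ a b) := by
    intro a b
    have := hq' ⟨a₀, 1, b⟩ ⟨a, 1, b₀⟩
    simpa [hmul, hleft, hright, hW, -WithOne.coe_mul, -Submodule.mkQ_apply] using this
  have hcomp : Ψ ∘ₗ reesToAbelianization C a₀ b₀ = W.mkQ ∘ₗ LinearMap.inr ℤ _ _ := by
    ext1 p
    ext1
    simp only [LinearMap.comp_apply, Finsupp.lsingle_apply, reesToAbelianization,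
      Finsupp.linearCombination_single, one_smul, LinearMap.inr_apply]
    refine (hC p.1 p.2).trans ?_
    have : reesGenerator a₀ b₀ (p.1 : A) (p.2 : B) = Finsupp.single p 1 := by
      simp [reesGenerator, p.1.2, p.2.2]
    rw [this]
  have h0 := LinearMap.congr_fun hcomp t
  rw [LinearMap.comp_apply, ht, map_zero, LinearMap.comp_apply, LinearMap.inr_apply, eq_comm,
    Submodule.mkQ_apply, Submodule.Quotient.mk_eq_zero] at h0
  obtain ⟨z, hz⟩ := h0
  exact ⟨z, congrArg Prod.fst hz, congrArg Prod.snd hz⟩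

end Rees

/-- Subgroups of finitely generated commutative groups are finitely generated. -/
theorem Subgroup.fg_of_commGroup {H : Type*} [CommGroup H] [Group.FG H] (K : Subgroup H) :
    K.FG := by
  have : Module.Finite ℤ (Additive H) := Module.Finite.iff_addGroup_fg.2 inferInstance
  rw [Subgroup.fg_iff_add_fg]
  have := IsNoetherian.noetherian (AddSubgroup.toIntSubmodule (M := Additive H) K.toAddSubgroup)
  exact (Submodule.fg_iff_addSubgroup_fg _).1 this

theorem mainTheorem11 {G : Type*} {A : Type*} {B : Type*} [Group G] (C : B → A → G)
    (a₀ : A) (b₀ : B)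
    (hrow : ∀ a : A, C b₀ a = 1) (hcol : ∀ b : B, C b a₀ = 1)
    [Nontrivial A] [Infinite B]
    (hFP : MonoidTypeFP (WithOne (ReesMatrix C)) 2) :
    ¬ (Subgroup.closure {x : Abelianization G | ∃ (a : A) (b : B), a ≠ a₀ ∧ b ≠ b₀ ∧
        x = Abelianization.of (C b a)}).FG ∧
      ¬ Group.FG G := by
  have main : ¬ (Subgroup.closure {x : Abelianization G | ∃ (a : A) (b : B), a ≠ a₀ ∧ b ≠ b₀ ∧
      x = Abelianization.of (C b a)}).FG := by
    intro hfg
    obtain ⟨N, hN, hcyc⟩ :=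
      hFP.exists_fg_of_isNormalizedCocycle (isNormalizedCocycle_reesCocycle C a₀ b₀)
    -- Containment in `N` suffices, since `N` is a Noetherian `ℤ`-module.
    have hker : (LinearMap.ker (reesToAbelianization C a₀ b₀)).FG := by
      have : Module.Finite ℤ N := Module.Finite.iff_fg.2 hN
      refine hN.of_le fun t ht => ?_
      obtain ⟨z, hz, rfl⟩ := exists_cycle_of_reesToAbelianization_eq_zero hrow hcol ht
      exact hcyc z hz
    have hrange : (LinearMap.range (reesToAbelianization C a₀ b₀)).FG := by
      rw [reesToAbelianization, Finsupp.range_linearCombination, Submodule.fg_iff_addSubgroup_fg,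
        Submodule.span_int_eq_addSubgroupClosure]
      rw [Subgroup.fg_iff_add_fg, Subgroup.toAddSubgroup_closure] at hfg
      convert! hfg using 2
      ext x
      constructor
      · rintro ⟨p, rfl⟩
        exact ⟨p.1, p.2, p.1.2, p.2.2, rfl⟩
      · rintro ⟨a, b, ha, hb, hx⟩
        exact ⟨(⟨a, ha⟩, ⟨b, hb⟩), hx.symm⟩
    have htop : (⊤ : Submodule ℤ (({a // a ≠ a₀} × {b // b ≠ b₀}) →₀ ℤ)).FG :=
      Submodule.fg_of_fg_map_of_fg_inf_ker (reesToAbelianization C a₀ b₀)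
        (by rwa [← LinearMap.range_eq_map]) (by rwa [top_inf_eq])
    have : Module.Finite ℤ (({a // a ≠ a₀} × {b // b ≠ b₀}) →₀ ℤ) := ⟨htop⟩
    have hfin := Module.Finite.finite_basis
      (Finsupp.basisSingleOne (R := ℤ) (ι := {a // a ≠ a₀} × {b // b ≠ b₀}))
    obtain ⟨a, ha⟩ := exists_ne a₀
    have : Infinite {b // b ≠ b₀} := (Set.finite_singleton b₀).infinite_compl.to_subtype
    have : Nonempty {a // a ≠ a₀} := ⟨⟨a, ha⟩⟩
    exact not_finite ({a // a ≠ a₀} × {b // b ≠ b₀})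
  refine ⟨main, fun hG => main ?_⟩
  have : Group.FG (Abelianization G) := QuotientGroup.fg _
  exact Subgroup.fg_of_commGroup _
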